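/- Let $m,n,p\in\mathbb N$, let $\mathcal A:\mathbb R^{m\times n}\to\mathbb R^p$ be linear, $b\in\mathbb R^p$, and let $r\ge 1$ be an integer. Equip $\mathbb R^{m\times n}$ with the scalar product $\langle X,Y\rangle=\operatorname{tr}(X^TY)$ and the Frobenius norm $\|\cdot\|_F$, and let $\mathcal A^*$ be the adjoint of $\mathcal A$. The singular values of a matrix $Z\in\mathbb R^{m\times n}$ are written $z_1\ge z_2\ge\dots\ge z_N\ge 0$, where $N=\min(m,n)$, and $z_i=0$ for $i>N$. Define $$\mathcal R_r(X)=\max_{Z\in\mathbb R^{m\times n}}\Big(\sum_{i=r+1}^N z_i^2-\|X-Z\|_F^2\Big),\qquad F(X)=\mathcal R_r(X)+\|\mathcal AX-b\|^2,\qquad G(X)=\mathcal R_r(X)+\|X\|_F^2 .$$ A stationary point of $F$ is a matrix $X$ with $0\in\partial F(X)$, where $\partial F(X)$ is the set of (Fréchet) subgradients of $F$ at $X$, i.e. of all $Y$ with $F(X+H)\ge F(X)+\langle Y,H\rangle-o(\|H\|_F)$ as $H\to0$; $\partial G$ is the subdifferential of $G$ in the sense of convex analysis. Suppose that $\mathcal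 A$ satisfies the restricted isometry property with constant $\delta_{2r}$, that is, $$(1-\delta_{2r})\|X\|_F^2\le\|\mathcal AX\|^2\le(1+\delta_{2r})\|X\|_F^2\quad\text{for all }X\text{ with }\operatorname{rank}(X)\le 2r .$$ Let $X_s$ be a stationary point of $F$ with $\operatorname{rank}(X_s)=r$, and put $Z=(I-\mathcal A^*\mathcal A)X_s+\mathcal A^*b$. Then $2Z\in\partial G(X_s)$. If moreover the singular values of $Z$ satisfy $z_{r+1}<(1-2\delta_{2r})\,z_r$, then every stationary point $X_s'\ne X_s$ of $F$ satisfies $\operatorname{rank}(X_s')>r$. -/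

import Mathlib

open Matrix Filter Topology

noncomputable section

namespace LowRankRelaxation

attribute [local instance] Matrix.frobeniusNormedAddCommGroup Matrix.frobeniusNormedSpace

/-- Real matrices with the scalar product `⟪X, Y⟫ = tr (Xᵀ Y)`; its norm is the Frobenius norm. -/
@[reducible]
def frobeniusInnerProductSpace (m n : ℕ) :
    InnerProductSpace ℝ (Matrix (Fin m) (Fin n) ℝ) where
  inner X Y := (Xᵀ * Y).trace
  norm_sq_eq_re_inner X := by
    rw [Matrix.frobenius_norm_def, ← Real.sqrt_eq_rpow, Real.sq_sqrt (by positivity)]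
    simp only [Matrix.trace, Matrix.diag, Matrix.mul_apply, Matrix.transpose_apply,
      RCLike.re_to_real]
    rw [Finset.sum_comm]
    refine Finset.sum_congr rfl fun i _ => Finset.sum_congr rfl fun j _ => ?_
    rw [Real.rpow_two, Real.norm_eq_abs, sq_abs, sq]
  conj_inner_symm X Y := by
    change (Yᵀ * X).trace = (Xᵀ * Y).trace
    rw [← Matrix.trace_transpose, Matrix.transpose_mul, Matrix.transpose_transpose]
  add_left X Y W := by
    change ((X + Y)ᵀ * W).trace = (Xᵀ * W).trace + (Yᵀ * W).trace
    rw [Matrix.transpose_add, Matrix.add_mul, Matrix.trace_add]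
  smul_left X Y c := by
    change ((c • X)ᵀ * Y).trace = c * (Xᵀ * Y).trace
    rw [Matrix.transpose_smul, Matrix.smul_mul, Matrix.trace_smul, smul_eq_mul]

attribute [local instance] frobeniusInnerProductSpace

/-- The singular values of a real matrix in non-increasing order, repeated with multiplicity,
counted from zero: `singularValue Z 0` is the largest one. They vanish from index `min m n` on. -/
def singularValue {m n : ℕ} (Z : Matrix (Fin m) (Fin n) ℝ) (i : ℕ) : ℝ :=
  (Matrix.toEuclideanLin Z).singularValues i

/-- The regularizer `R_r(X) = max_Z (∑_{i > r} z_i ^ 2 - ‖X - Z‖_F ^ 2)`, where `z_1 ≥ z_2 ≥ …`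
are the singular values of `Z`. For `r ≥ 1` the maximum is attained, so that it is the supremum
written here. -/
def regularizer {m n : ℕ} (r : ℕ) (X : Matrix (Fin m) (Fin n) ℝ) : ℝ :=
  ⨆ Z : Matrix (Fin m) (Fin n) ℝ,
    (∑ i ∈ Finset.Ico r (min m n), singularValue Z i ^ 2) - ‖X - Z‖ ^ 2

/-- `F(X) = R_r(X) + ‖A X - b‖ ^ 2`. -/
def objective {m n p : ℕ} (r : ℕ)
    (A : Matrix (Fin m) (Fin n) ℝ →ₗ[ℝ] EuclideanSpace ℝ (Fin p))
    (b : EuclideanSpace ℝ (Fin p)) (X : Matrix (Fin m) (Fin n) ℝ) : ℝ :=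
  regularizer r X + ‖A X - b‖ ^ 2

/-- `G(X) = R_r(X) + ‖X‖_F ^ 2`. -/
def convexPart {m n : ℕ} (r : ℕ) (X : Matrix (Fin m) (Fin n) ℝ) : ℝ :=
  regularizer r X + ‖X‖ ^ 2

/-- The subdifferential of convex analysis. -/
def convexSubdifferential {E : Type*} [NormedAddCommGroup E] [InnerProductSpace ℝ E]
    (f : E → ℝ) (x : E) : Set E :=
  {g | ∀ y, f x + inner ℝ g (y - x) ≤ f y}

/-- The Fréchet (regular) subdifferential of a function that need not be convex:
`g` belongs to it if `f y ≥ f x + ⟪g, y - x⟫ - o(‖y - x‖)` as `y → x`. -/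
def frechetSubdifferential {E : Type*} [NormedAddCommGroup E] [InnerProductSpace ℝ E]
    (f : E → ℝ) (x : E) : Set E :=
  {g | ∀ ε : ℝ, 0 < ε → ∀ᶠ y in 𝓝 x, f x + inner ℝ g (y - x) - ε * ‖y - x‖ ≤ f y}

/-- A stationary point: zero is a subgradient. -/
def IsStationaryPoint {E : Type*} [NormedAddCommGroup E] [InnerProductSpace ℝ E]
    (f : E → ℝ) (x : E) : Prop :=
  (0 : E) ∈ frechetSubdifferential f x

/-- The restricted isometry property of order `q` with constant `δ`. -/
def HasRIP {m n p : ℕ} (A : Matrix (Fin m) (Fin n) ℝ →ₗ[ℝ] EuclideanSpace ℝ (Fin p))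
    (q : ℕ) (δ : ℝ) : Prop :=
  ∀ X : Matrix (Fin m) (Fin n) ℝ, X.rank ≤ q →
    (1 - δ) * ‖X‖ ^ 2 ≤ ‖A X‖ ^ 2 ∧ ‖A X‖ ^ 2 ≤ (1 + δ) * ‖X‖ ^ 2

/-- `Z = (I - A* A) X + A* b`, with `A*` the adjoint of `A` for the trace scalar product on
matrices and the Euclidean one on `ℝ^p`. -/
def dualPoint {m n p : ℕ} (A : Matrix (Fin m) (Fin n) ℝ →ₗ[ℝ] EuclideanSpace ℝ (Fin p))
    (b : EuclideanSpace ℝ (Fin p)) (X : Matrix (Fin m) (Fin n) ℝ) :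
    Matrix (Fin m) (Fin n) ℝ :=
  (X - A.adjoint (A X)) + A.adjoint b

end LowRankRelaxation

end

attribute [local instance] Matrix.frobeniusNormedAddCommGroup Matrix.frobeniusNormedSpace
  LowRankRelaxation.frobeniusInnerProductSpace

/-!
For `X` of rank at most `r` the regularizer vanishes, by the Eckart–Young inequality
(`sum_tail_le_norm_sub_sq`), so `G(X) = ‖X‖²` there. In general `G` is a supremum of affine
functions, bounded above because the largest singular value carries at least the fraction `1 / n` of
the squared norm; hence `G` is convex. Since `F - G` is the quadratic `‖A X - b‖² - ‖X‖²`, whose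
gradient at `X` is `-2 Z`, a stationary point of `F` satisfies the first-order inequality for `2 Z`
along every ray, and convexity makes `2 Z` a subgradient of `G` (`two_smul_dualPoint_mem`).

Tested on matrices of rank at most `r`, this subgradient inequality says that a stationary point
`X` of rank at most `r` is a best approximation of `Z` of such rank (`norm_sub_sq_le_of_mem`).
Hence, with `E = Z - X`, `2 ⟪E, Y - X⟫ ≤ ‖Y - X‖²` for all `Y` of rank at most `r`.
If `z_{r+1} ≤ s z_r` with
`0 < s` and `z_{r+1} < z_r`, then equality in Eckart–Young forces `X` to be the truncation of the
singular value decomposition of `Z`, and `s X` is still a best approximation of `s X + E`; therefore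
`2 ⟪E, Y - X⟫ ≤ s ‖Y - X‖²` (`two_mul_inner_le_of_gap`).

Now let `X` and `X'` be two distinct stationary points of rank at most `r`, with a gap
`s < 1 - 2 δ` at `X`, and put `D = ‖X' - X‖²`. Adding the two estimates gives
`⟪Z' - Z, X' - X⟫ ≥ D - D / 2 - s D / 2 > δ D`, while `Z' - Z = (I - A* A) (X' - X)` and the
restricted isometry property give `⟪Z' - Z, X' - X⟫ = D - ‖A (X' - X)‖² ≤ δ D`.

The Eckart–Young inequality and its equality case rest on the following: if the `M v i` are pairwise
orthogonal and `u` is an orthonormal basis with `Y u j = 0` for `j ≥ r`, then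
`‖M - Y‖² ≥ ∑_{j ≥ r} ‖M u j‖² = ∑ i, ‖M v i‖² d i` with weights `d i ∈ [0, 1]` of sum `n - r` when
`r ≤ n`.
-/

attribute [local instance] Matrix.frobeniusNormedAddCommGroup Matrix.frobeniusNormedSpace
  LowRankRelaxation.frobeniusInnerProductSpace

namespace LowRankRelaxation

/-! ### Frobenius norm and right singular vectors -/

variable {m n p : ℕ}

/-- The trace scalar product is the Hilbert–Schmidt one, computable in any orthonormal basis. -/
theorem inner_eq_sum_inner (X Y : Matrix (Fin m) (Fin n) ℝ)
    (v : OrthonormalBasis (Fin n) ℝ (EuclideanSpace ℝ (Fin n))) :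
    inner ℝ X Y = ∑ i, inner ℝ (X.toEuclideanLin (v i)) (Y.toEuclideanLin (v i)) := by
  have h : Matrix.trace (Xᵀ * Y) =
      LinearMap.trace ℝ _ (LinearMap.adjoint X.toEuclideanLin ∘ₗ Y.toEuclideanLin) := by
    rw [← Matrix.toEuclideanLin_conjTranspose_eq_adjoint,
      Matrix.toEuclideanLin_eq_toLin_orthonormal, Matrix.toEuclideanLin_eq_toLin_orthonormal,
      ← Matrix.toLin_mul, Matrix.trace_toLin_eq,
      Matrix.conjTranspose_eq_transpose_of_trivial]
  change Matrix.trace (Xᵀ * Y) = _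
  rw [h, LinearMap.trace_eq_sum_inner _ v]
  simp [LinearMap.adjoint_inner_right]

theorem norm_sq_eq_sum_norm_sq (X : Matrix (Fin m) (Fin n) ℝ)
    (v : OrthonormalBasis (Fin n) ℝ (EuclideanSpace ℝ (Fin n))) :
    ‖X‖ ^ 2 = ∑ i, ‖X.toEuclideanLin (v i)‖ ^ 2 := by
  rw [← real_inner_self_eq_norm_sq, inner_eq_sum_inner X X v]
  simp

/-- Every real matrix has an orthonormal basis of right singular vectors. Its images are pairwise
orthogonal, and their lengths are the singular values. -/
theorem exists_rightSingularBasis (X : Matrix (Fin m) (Fin n) ℝ) :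
    ∃ v : OrthonormalBasis (Fin n) ℝ (EuclideanSpace ℝ (Fin n)),
      (∀ i j, i ≠ j → inner ℝ (X.toEuclideanLin (v i)) (X.toEuclideanLin (v j)) = 0) ∧
      ∀ i, ‖X.toEuclideanLin (v i)‖ = singularValue X i := by
  have hfin : Module.finrank ℝ (EuclideanSpace ℝ (Fin n)) = n := by simp
  let T := X.toEuclideanLin
  let v := T.isSymmetric_adjoint_comp_self.eigenvectorBasis hfin
  have h : ∀ i j, inner ℝ (T (v i)) (T (v j)) =
      T.isSymmetric_adjoint_comp_self.eigenvalues hfin j * inner ℝ (v i) (v j) := by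
    intro i j
    rw [← LinearMap.adjoint_inner_right, ← LinearMap.comp_apply,
      LinearMap.IsSymmetric.apply_eigenvectorBasis, inner_smul_right]
    rfl
  refine ⟨v, fun i j hij => ?_, fun i => ?_⟩
  · change inner ℝ (T (v i)) (T (v j)) = 0
    rw [h, v.inner_eq_zero hij, mul_zero]
  · change ‖T (v i)‖ = T.singularValues i
    refine (sq_eq_sq₀ (norm_nonneg _) (T.singularValues_nonneg _)).1 ?_
    rw [T.sq_singularValues_fin hfin, ← real_inner_self_eq_norm_sq, h]
    simp

theorem singularValue_eq_zero_iff (X : Matrix (Fin m) (Fin n) ℝ) {i : ℕ} :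
    singularValue X i = 0 ↔ X.rank ≤ i := by
  rw [Matrix.rank_eq_finrank_range_toLin X (EuclideanSpace.basisFun (Fin m) ℝ).toBasis
    (EuclideanSpace.basisFun (Fin n) ℝ).toBasis, ← Matrix.toEuclideanLin_eq_toLin_orthonormal]
  exact LinearMap.singularValues_eq_zero_iff_le_finrank_range _

theorem singularValue_antitone (X : Matrix (Fin m) (Fin n) ℝ) : Antitone (singularValue X) :=
  LinearMap.singularValues_antitone _

theorem singularValue_nonneg (X : Matrix (Fin m) (Fin n) ℝ) (i : ℕ) : 0 ≤ singularValue X i :=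
  LinearMap.singularValues_nonneg _ i

theorem exists_basis_apply_eq_zero {r : ℕ} (Y : Matrix (Fin m) (Fin n) ℝ) (hY : Y.rank ≤ r) :
    ∃ u : OrthonormalBasis (Fin n) ℝ (EuclideanSpace ℝ (Fin n)),
      ∀ j : Fin n, r ≤ j → Y.toEuclideanLin (u j) = 0 := by
  obtain ⟨u, -, hu⟩ := exists_rightSingularBasis Y
  refine ⟨u, fun j hj => ?_⟩
  rw [← norm_eq_zero, hu, singularValue_eq_zero_iff]
  exact hY.trans hj

/-- The tail sum in the regularizer, taken over all right singular vectors instead of the first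
`min m n` ones. -/
theorem sum_Ico_singularValue_sq (r : ℕ) (X : Matrix (Fin m) (Fin n) ℝ) :
    ∑ i ∈ Finset.Ico r (min m n), singularValue X i ^ 2 =
      ∑ i : Fin n with r ≤ i.val, singularValue X i ^ 2 := by
  rw [Finset.sum_filter,
    Fin.sum_univ_eq_sum_range (fun i => if r ≤ i then singularValue X i ^ 2 else 0),
    ← Finset.sum_filter]
  refine Finset.sum_subset (fun i => by simp; omega) fun i hi hi' => ?_
  have : X.rank ≤ i := by
    have h1 := X.rank_le_height
    simp at hi hi'
    omega
  rw [(singularValue_eq_zero_iff X).2 this]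
  simp

/-! ### Weighted sums and the Eckart–Young inequality -/

/-- Among all weights in `[0, 1]` of a given total, the weighted sum is smallest when the weights
are concentrated on the indices from `r` on. -/
theorem sum_le_sum_weighted {r : ℕ} {c : ℝ} {a d : Fin n → ℝ}
    (ha : ∀ i : Fin n, i.val < r → c ≤ a i) (ha' : ∀ i : Fin n, r ≤ i.val → a i ≤ c)
    (hd : ∀ i, 0 ≤ d i) (hd' : ∀ i, d i ≤ 1)
    (hsum : ∑ i, d i = ((Finset.univ.filter fun i : Fin n => r ≤ i.val).card : ℝ)) :
    ∑ i : Fin n with r ≤ i.val, a i ≤ ∑ i, a i * d i := by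
  have h1 : ∑ i : Fin n, c * (d i - if r ≤ i.val then 1 else 0) = 0 := by
    rw [← Finset.mul_sum, Finset.sum_sub_distrib, hsum]
    simp
  rw [Finset.sum_filter, ← sub_nonneg, ← h1, ← Finset.sum_sub_distrib]
  refine Finset.sum_le_sum fun i _ => ?_
  split_ifs with h
  · nlinarith [ha' i h, hd' i]
  · nlinarith [ha i (by omega), hd i]

/-- Equality in the weighted sum forces the extremal weights as soon as there is a gap. -/
theorem weights_eq_of_sum_le {r : ℕ} {c c' : ℝ} {a d : Fin n → ℝ} (hcc : c' < c)
    (ha : ∀ i : Fin n, i.val < r → c ≤ a i) (ha' : ∀ i : Fin n, r ≤ i.val → a i ≤ c')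
    (hd : ∀ i, 0 ≤ d i) (hd' : ∀ i, d i ≤ 1)
    (hsum : ∑ i, d i = ((Finset.univ.filter fun i : Fin n => r ≤ i.val).card : ℝ))
    (hle : ∑ i, a i * d i ≤ ∑ i : Fin n with r ≤ i.val, a i) :
    ∀ i : Fin n, d i = if r ≤ i.val then 1 else 0 := by
  -- the middle of the gap: with it every summand in `h2` has a sign, strictly so unless its
  -- weight is extremal
  set e : ℝ := (c + c') / 2 with he
  have h1 : ∑ i : Fin n, (d i - if r ≤ i.val then 1 else 0) = 0 := by
    rw [Finset.sum_sub_distrib, hsum]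
    simp
  have h2 : ∀ i ∈ Finset.univ, 0 ≤ (a i - e) * (d i - if r ≤ i.val then 1 else 0) := by
    intro i _
    split_ifs with h
    · nlinarith [ha' i h, hd' i]
    · nlinarith [ha i (by omega), hd i]
  have h3 : ∑ i : Fin n, (a i - e) * (d i - if r ≤ i.val then 1 else 0) ≤ 0 := by
    have : ∑ i : Fin n, (a i - e) * (d i - if r ≤ i.val then 1 else 0) =
        ∑ i, a i * d i - ∑ i : Fin n with r ≤ i.val, a i -
          e * ∑ i : Fin n, (d i - if r ≤ i.val then 1 else 0) := by
      rw [Finset.sum_filter, Finset.mul_sum, ← Finset.sum_sub_distrib, ← Finset.sum_sub_distrib]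
      refine Finset.sum_congr rfl fun i _ => ?_
      split_ifs <;> ring
    rw [this, h1]
    linarith
  have h4 := (Finset.sum_eq_zero_iff_of_nonneg h2).1 (le_antisymm h3 (Finset.sum_nonneg h2))
  intro i
  have h5 := h4 i (Finset.mem_univ i)
  refine sub_eq_zero.1 ((mul_eq_zero.1 h5).resolve_left ?_)
  by_cases h : r ≤ i.val
  · have := ha' i h; intro h'; linarith
  · have := ha i (by omega); intro h'; linarith

section tailWeight

variable (r : ℕ) (u v : OrthonormalBasis (Fin n) ℝ (EuclideanSpace ℝ (Fin n)))

/-- The squared length of the projection of `v i` onto the span of the `u j` with `j ≥ r`. -/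
noncomputable def tailWeight (i : Fin n) : ℝ :=
  ∑ j : Fin n with r ≤ j.val, inner ℝ (v i) (u j) ^ 2

theorem tailWeight_nonneg (i : Fin n) : 0 ≤ tailWeight r u v i :=
  Finset.sum_nonneg fun _ _ => sq_nonneg _

theorem tailWeight_add (i : Fin n) :
    tailWeight r u v i + ∑ j : Fin n with ¬ r ≤ j.val, inner ℝ (v i) (u j) ^ 2 = 1 := by
  rw [tailWeight, Finset.sum_filter_add_sum_filter_not]
  simpa using u.sum_sq_norm_inner_left (v i)

theorem tailWeight_le_one (i : Fin n) : tailWeight r u v i ≤ 1 := by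
  have : 0 ≤ ∑ j : Fin n with ¬ r ≤ j.val, inner ℝ (v i) (u j) ^ 2 :=
    Finset.sum_nonneg fun _ _ => sq_nonneg _
  linarith [tailWeight_add r u v i]

theorem sum_tailWeight :
    ∑ i, tailWeight r u v i = ((Finset.univ.filter fun i : Fin n => r ≤ i.val).card : ℝ) := by
  simp only [tailWeight]
  rw [Finset.sum_comm, Finset.card_eq_sum_ones]
  push_cast
  refine Finset.sum_congr rfl fun j _ => ?_
  simpa using v.sum_sq_norm_inner_right (u j)

/-- If the `M v i` are pairwise orthogonal, the part of the Frobenius norm of `M` carried by the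
`u j` with `j ≥ r` is a weighted sum of the `‖M v i‖ ^ 2`. -/
theorem sum_tail_norm_sq_eq (M : Matrix (Fin m) (Fin n) ℝ)
    (hM : ∀ i j, i ≠ j → inner ℝ (M.toEuclideanLin (v i)) (M.toEuclideanLin (v j)) = 0) :
    ∑ j : Fin n with r ≤ j.val, ‖M.toEuclideanLin (u j)‖ ^ 2 =
      ∑ i, ‖M.toEuclideanLin (v i)‖ ^ 2 * tailWeight r u v i := by
  have h : ∀ j, ‖M.toEuclideanLin (u j)‖ ^ 2 =
      ∑ i, ‖M.toEuclideanLin (v i)‖ ^ 2 * inner ℝ (v i) (u j) ^ 2 := by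
    intro j
    have h1 : M.toEuclideanLin (u j) =
        ∑ i, inner ℝ (v i) (u j) • M.toEuclideanLin (v i) := by
      conv_lhs => rw [← v.sum_repr' (u j)]
      simp
    rw [← real_inner_self_eq_norm_sq, h1, sum_inner]
    refine Finset.sum_congr rfl fun i _ => ?_
    rw [inner_sum, Finset.sum_eq_single i]
    · rw [inner_smul_left, inner_smul_right, real_inner_self_eq_norm_sq]
      simp only [conj_trivial]
      ring
    · intro k _ hk
      rw [inner_smul_left, inner_smul_right, hM i k hk.symm]
      simp
    · simp
  simp_rw [h, tailWeight, Finset.mul_sum]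
  rw [Finset.sum_comm]

end tailWeight

theorem sum_tail_norm_sq_le_norm_sub_sq {r : ℕ} {M Y : Matrix (Fin m) (Fin n) ℝ}
    (u : OrthonormalBasis (Fin n) ℝ (EuclideanSpace ℝ (Fin n)))
    (hu : ∀ j : Fin n, r ≤ j.val → Y.toEuclideanLin (u j) = 0) :
    ∑ j : Fin n with r ≤ j.val, ‖M.toEuclideanLin (u j)‖ ^ 2 ≤ ‖M - Y‖ ^ 2 := by
  rw [norm_sq_eq_sum_norm_sq (M - Y) u, Finset.sum_filter]
  refine Finset.sum_le_sum fun j _ => ?_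
  split_ifs with h
  · simp [hu j h]
  · positivity

/-- **Eckart–Young inequality**: the tail of a matrix bounds its distance to the matrices of
rank at most `r`. The singular vectors need not be sorted; a threshold `c` between the first `r`
and the remaining squared lengths suffices. -/
theorem sum_tail_le_norm_sub_sq {r : ℕ} {c : ℝ} {M Y : Matrix (Fin m) (Fin n) ℝ}
    (v : OrthonormalBasis (Fin n) ℝ (EuclideanSpace ℝ (Fin n)))
    (hM : ∀ i j, i ≠ j → inner ℝ (M.toEuclideanLin (v i)) (M.toEuclideanLin (v j)) = 0)
    (ha : ∀ i : Fin n, i.val < r → c ≤ ‖M.toEuclideanLin (v i)‖ ^ 2)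
    (ha' : ∀ i : Fin n, r ≤ i.val → ‖M.toEuclideanLin (v i)‖ ^ 2 ≤ c)
    (hY : Y.rank ≤ r) :
    ∑ i : Fin n with r ≤ i.val, ‖M.toEuclideanLin (v i)‖ ^ 2 ≤ ‖M - Y‖ ^ 2 := by
  obtain ⟨u, hu⟩ := exists_basis_apply_eq_zero Y hY
  refine le_trans ?_ (sum_tail_norm_sq_le_norm_sub_sq (M := M) u hu)
  rw [sum_tail_norm_sq_eq r u v M hM]
  exact sum_le_sum_weighted ha ha' (tailWeight_nonneg r u v) (tailWeight_le_one r u v)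
    (sum_tailWeight r u v)

theorem sum_singularValue_sq_le {r : ℕ} (M : Matrix (Fin m) (Fin n) ℝ)
    {Y : Matrix (Fin m) (Fin n) ℝ} (hY : Y.rank ≤ r) :
    ∑ i ∈ Finset.Ico r (min m n), singularValue M i ^ 2 ≤ ‖M - Y‖ ^ 2 := by
  obtain ⟨v, hv, hv'⟩ := exists_rightSingularBasis M
  rw [sum_Ico_singularValue_sq]
  have := sum_tail_le_norm_sub_sq (c := singularValue M r ^ 2) (M := M) v hv
    (fun i hi => ?_) (fun i hi => ?_) hY
  · simpa only [hv'] using this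
  · rw [hv']
    exact pow_le_pow_left₀ (singularValue_nonneg _ _) (singularValue_antitone _ hi.le) 2
  · rw [hv']
    exact pow_le_pow_left₀ (singularValue_nonneg _ _) (singularValue_antitone _ hi) 2

/-! ### Best approximations of bounded rank -/

/-- The witness `W` agrees with `M` on the first `r` vectors of `v` and kills the others. -/
theorem exists_truncation (r : ℕ) (M : Matrix (Fin m) (Fin n) ℝ)
    (v : OrthonormalBasis (Fin n) ℝ (EuclideanSpace ℝ (Fin n))) :
    ∃ W : Matrix (Fin m) (Fin n) ℝ, W.rank ≤ r ∧
      ‖M - W‖ ^ 2 = ∑ i : Fin n with r ≤ i.val, ‖M.toEuclideanLin (v i)‖ ^ 2 := by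
  let S : EuclideanSpace ℝ (Fin n) →ₗ[ℝ] EuclideanSpace ℝ (Fin m) :=
    v.toBasis.constr ℝ fun i => if r ≤ i.val then 0 else M.toEuclideanLin (v i)
  have hS : ∀ i, S (v i) = if r ≤ i.val then 0 else M.toEuclideanLin (v i) := by
    intro i
    have := v.toBasis.constr_basis ℝ (fun i => if r ≤ i.val then 0 else M.toEuclideanLin (v i)) i
    rwa [OrthonormalBasis.coe_toBasis] at this
  have hW : (Matrix.toEuclideanLin.symm S).toEuclideanLin = S :=
    Matrix.toEuclideanLin.apply_symm_apply S
  refine ⟨Matrix.toEuclideanLin.symm S, ?_, ?_⟩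
  · rw [Matrix.rank_eq_finrank_range_toLin _ (EuclideanSpace.basisFun (Fin m) ℝ).toBasis
      (EuclideanSpace.basisFun (Fin n) ℝ).toBasis, ← Matrix.toEuclideanLin_eq_toLin_orthonormal, hW]
    have hr : LinearMap.range S ≤ Submodule.span ℝ
        ((Finset.univ.filter fun i : Fin n => ¬ r ≤ i.val).image
          fun i => M.toEuclideanLin (v i) : Set (EuclideanSpace ℝ (Fin m))) := by
      rw [LinearMap.range_eq_map, ← v.toBasis.span_eq, Submodule.map_span, Submodule.span_le]
      rintro _ ⟨_, ⟨i, rfl⟩, rfl⟩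
      rw [OrthonormalBasis.coe_toBasis, hS]
      split_ifs with h
      · simp
      · exact Submodule.subset_span (by simpa using ⟨i, by omega, rfl⟩)
    refine (Submodule.finrank_mono hr).trans ((finrank_span_finset_le_card _).trans
      (Finset.card_image_le.trans ?_))
    refine (Finset.card_le_card_of_injOn (t := Finset.range r) (fun i => i.val) ?_ ?_).trans
      (by simp)
    · intro i; simp
    · exact Fin.val_injective.injOn
  · rw [norm_sq_eq_sum_norm_sq _ v, Finset.sum_filter]
    refine Finset.sum_congr rfl fun i _ => ?_
    rw [map_sub, hW, LinearMap.sub_apply, hS]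
    split_ifs <;> simp

/-- A best approximation of rank at most `r` is the truncated singular value decomposition if there
is a gap between the `r`-th singular value and the next. -/
theorem apply_eq_of_best_approx {r : ℕ} {X Z : Matrix (Fin m) (Fin n) ℝ} (hX : X.rank ≤ r)
    (hbest : ∀ Y : Matrix (Fin m) (Fin n) ℝ, Y.rank ≤ r → ‖Z - X‖ ^ 2 ≤ ‖Z - Y‖ ^ 2)
    (hgap : singularValue Z r < singularValue Z (r - 1))
    (v : OrthonormalBasis (Fin n) ℝ (EuclideanSpace ℝ (Fin n)))
    (hv : ∀ i j, i ≠ j → inner ℝ (Z.toEuclideanLin (v i)) (Z.toEuclideanLin (v j)) = 0)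
    (hv' : ∀ i, ‖Z.toEuclideanLin (v i)‖ = singularValue Z i) (i : Fin n) :
    X.toEuclideanLin (v i) = if r ≤ i.val then 0 else Z.toEuclideanLin (v i) := by
  obtain ⟨u, hu⟩ := exists_basis_apply_eq_zero X hX
  obtain ⟨W, hW, hW'⟩ := exists_truncation r Z v
  have hnorm : ‖Z - X‖ ^ 2 = ∑ j, ‖(Z - X).toEuclideanLin (u j)‖ ^ 2 := norm_sq_eq_sum_norm_sq _ u
  rw [← Finset.sum_filter_add_sum_filter_not _ (fun j : Fin n => r ≤ j.val)] at hnorm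
  have htail : ∑ j : Fin n with r ≤ j.val, ‖(Z - X).toEuclideanLin (u j)‖ ^ 2 =
      ∑ i, ‖Z.toEuclideanLin (v i)‖ ^ 2 * tailWeight r u v i := by
    rw [← sum_tail_norm_sq_eq r u v Z hv]
    refine Finset.sum_congr rfl fun j hj => ?_
    simp [hu j (by simpa using hj)]
  have hsq : singularValue Z r ^ 2 < singularValue Z (r - 1) ^ 2 :=
    pow_lt_pow_left₀ hgap (singularValue_nonneg _ _) two_ne_zero
  have ha : ∀ i : Fin n, i.val < r → singularValue Z (r - 1) ^ 2 ≤ ‖Z.toEuclideanLin (v i)‖ ^ 2 :=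
    fun i hi => by
      rw [hv']
      exact pow_le_pow_left₀ (singularValue_nonneg _ _) (singularValue_antitone _ (by omega)) 2
  have ha' : ∀ i : Fin n, r ≤ i.val → ‖Z.toEuclideanLin (v i)‖ ^ 2 ≤ singularValue Z r ^ 2 :=
    fun i hi => by
      rw [hv']
      exact pow_le_pow_left₀ (singularValue_nonneg _ _) (singularValue_antitone _ hi) 2
  have hlow := sum_le_sum_weighted (fun i hi => hsq.le.trans (ha i hi))
    ha' (tailWeight_nonneg r u v) (tailWeight_le_one r u v) (sum_tailWeight r u v)
  have hle := hbest W hW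
  rw [hW', hnorm, htail] at hle
  have hnn : ∀ j ∈ Finset.univ.filter (fun j : Fin n => ¬ r ≤ j.val),
      0 ≤ ‖(Z - X).toEuclideanLin (u j)‖ ^ 2 := fun _ _ => by positivity
  have hpos := Finset.sum_nonneg hnn
  have hweights := weights_eq_of_sum_le hsq ha ha' (tailWeight_nonneg r u v)
    (tailWeight_le_one r u v) (sum_tailWeight r u v) (by linarith)
  have hhead := (Finset.sum_eq_zero_iff_of_nonneg hnn).1 (by linarith)
  have hadd := tailWeight_add r u v i
  have hvi : v i = ∑ j, inner ℝ (u j) (v i) • u j := (u.sum_repr' (v i)).symm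
  rw [hweights i] at hadd
  split_ifs at hadd ⊢ with h
  -- `v i` lies in the span of the `u j` with `j ≥ r`, which `X` kills
  · have h0 : ∑ j : Fin n with ¬ r ≤ j.val, inner ℝ (v i) (u j) ^ 2 = 0 := by linarith
    have h1 := (Finset.sum_eq_zero_iff_of_nonneg fun _ _ => sq_nonneg _).1 h0
    rw [hvi, map_sum]
    refine Finset.sum_eq_zero fun j _ => ?_
    rw [map_smul]
    by_cases hj : r ≤ j.val
    · rw [hu j hj, smul_zero]
    · have h2 := h1 j (by simpa using hj)
      rw [real_inner_comm, pow_eq_zero_iff two_ne_zero] at h2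
      rw [h2, zero_smul]
  -- `v i` lies in the span of the `u j` with `j < r`, which `Z - X` kills
  · have h0 : tailWeight r u v i = 0 := by rw [hweights i, if_neg h]
    have h1 := (Finset.sum_eq_zero_iff_of_nonneg fun _ _ => sq_nonneg _).1 h0
    have h3 : (Z - X).toEuclideanLin (v i) = 0 := by
      rw [hvi, map_sum]
      refine Finset.sum_eq_zero fun j _ => ?_
      rw [map_smul]
      by_cases hj : r ≤ j.val
      · have h2 := h1 j (by simpa using hj)
        rw [real_inner_comm, pow_eq_zero_iff two_ne_zero] at h2
        rw [h2, zero_smul]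
      · have h2 := hhead j (by simpa using hj)
        rw [pow_eq_zero_iff two_ne_zero, norm_eq_zero] at h2
        rw [h2, smul_zero]
    rw [map_sub, LinearMap.sub_apply, sub_eq_zero] at h3
    exact h3.symm

/-! ### The regularizer and the convex part -/

/-- The largest singular value carries at least the fraction `1 / n` of the squared norm. -/
theorem mul_sum_singularValue_sq_le {r : ℕ} (hr : 1 ≤ r) (Z : Matrix (Fin m) (Fin n) ℝ) :
    n * ∑ i ∈ Finset.Ico r (min m n), singularValue Z i ^ 2 ≤ (n - 1) * ‖Z‖ ^ 2 := by
  obtain ⟨v, -, hv⟩ := exists_rightSingularBasis Z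
  have hnorm : ‖Z‖ ^ 2 = ∑ i : Fin n, singularValue Z i ^ 2 := by
    simp_rw [norm_sq_eq_sum_norm_sq Z v, hv]
  rcases Nat.eq_zero_or_pos n with rfl | hn
  · simp [hnorm]
  have htop : ‖Z‖ ^ 2 ≤ n * singularValue Z 0 ^ 2 := by
    rw [hnorm]
    refine (Finset.sum_le_card_nsmul _ _ (singularValue Z 0 ^ 2) fun i _ => ?_).trans (by simp)
    exact pow_le_pow_left₀ (singularValue_nonneg _ _) (singularValue_antitone _ (Nat.zero_le _)) 2
  have htail : ∑ i ∈ Finset.Ico r (min m n), singularValue Z i ^ 2 + singularValue Z 0 ^ 2 ≤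
      ‖Z‖ ^ 2 := by
    rw [hnorm, sum_Ico_singularValue_sq, Finset.sum_filter,
      ← Finset.add_sum_erase _ _ (Finset.mem_univ (⟨0, hn⟩ : Fin n)),
      ← Finset.add_sum_erase _ (fun i : Fin n => singularValue Z i ^ 2)
        (Finset.mem_univ (⟨0, hn⟩ : Fin n)), if_neg (by simp; omega), zero_add, add_comm]
    refine add_le_add_right (Finset.sum_le_sum fun i _ => ?_) _
    split_ifs
    · exact le_rfl
    · positivity
  have hn' : (0 : ℝ) ≤ n := Nat.cast_nonneg n
  nlinarith

/-- Without this bound the supremum in `regularizer` would be the junk value `0`. -/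
theorem bddAbove_regularizer {r : ℕ} (hr : 1 ≤ r) (X : Matrix (Fin m) (Fin n) ℝ) :
    BddAbove (Set.range fun Z : Matrix (Fin m) (Fin n) ℝ =>
      (∑ i ∈ Finset.Ico r (min m n), singularValue Z i ^ 2) - ‖X - Z‖ ^ 2) := by
  rcases Nat.eq_zero_or_pos n with rfl | hn
  · refine ⟨0, ?_⟩
    rintro _ ⟨Z, rfl⟩
    simp
  refine ⟨n * ‖X‖ ^ 2, ?_⟩
  rintro _ ⟨Z, rfl⟩
  have h1 := mul_sum_singularValue_sq_le hr Z
  have h2 := norm_sub_sq_real X Z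
  have hn' : (1 : ℝ) ≤ n := by exact_mod_cast hn
  -- `(1 - 1 / n) ‖Z‖² - ‖X - Z‖²` is largest at `Z = n X`, so the square is completed there
  have h3 := norm_sub_sq_real ((n : ℝ) • X) Z
  rw [norm_smul, inner_smul_left] at h3
  simp only [Real.norm_natCast, conj_trivial] at h3
  have h4 := sq_nonneg ‖(n : ℝ) • X - Z‖
  refine le_of_mul_le_mul_left ?_ (by linarith : (0 : ℝ) < n)
  dsimp only
  nlinarith [mul_nonneg (by linarith : (0 : ℝ) ≤ n) (sq_nonneg ‖X‖)]

theorem regularizer_eq_zero {r : ℕ} (hr : 1 ≤ r) {X : Matrix (Fin m) (Fin n) ℝ}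
    (hX : X.rank ≤ r) : regularizer r X = 0 := by
  refine le_antisymm (ciSup_le fun Z => ?_) ?_
  · have := sum_singularValue_sq_le Z hX
    rw [norm_sub_rev]
    linarith
  · refine le_trans ?_ (le_ciSup (bddAbove_regularizer hr X) X)
    simpa using Finset.sum_nonneg fun i _ => sq_nonneg (singularValue X i)

theorem convexPart_of_rank_le {r : ℕ} (hr : 1 ≤ r) {X : Matrix (Fin m) (Fin n) ℝ}
    (hX : X.rank ≤ r) : convexPart r X = ‖X‖ ^ 2 := by
  rw [convexPart, regularizer_eq_zero hr hX, zero_add]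

/-- After adding `‖X‖²`, each term of the supremum is affine in `X`. -/
theorem convexOn_convexPart {r : ℕ} (hr : 1 ≤ r) :
    ConvexOn ℝ Set.univ (convexPart r : Matrix (Fin m) (Fin n) ℝ → ℝ) := by
  refine ⟨convex_univ, fun X _ Y _ s t hs ht hst => ?_⟩
  rw [convexPart, ← le_sub_iff_add_le]
  refine ciSup_le fun Z => ?_
  have hX := le_ciSup (bddAbove_regularizer hr X) Z
  have hY := le_ciSup (bddAbove_regularizer hr Y) Z
  change _ ≤ regularizer r X at hX
  change _ ≤ regularizer r Y at hY
  simp only [convexPart, smul_eq_mul]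
  have h1 := norm_sub_sq_real X Z
  have h2 := norm_sub_sq_real Y Z
  have h3 := norm_sub_sq_real (s • X + t • Y) Z
  rw [inner_add_left, inner_smul_left, inner_smul_left] at h3
  simp only [conj_trivial] at h3
  have hX' := mul_le_mul_of_nonneg_left hX hs
  have hY' := mul_le_mul_of_nonneg_left hY ht
  obtain rfl : t = 1 - s := by linarith
  rw [h1] at hX'
  rw [h2] at hY'
  rw [h3]
  nlinarith

/-! ### Stationary points and subgradients -/

/-- The difference of the objective and the convex part is the quadratic `‖A X - b‖² - ‖X‖²`,
whose gradient at `X` is `-2 Z`; along each ray its second-order part is negligible, and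
convexity turns the first-order inequality into a global one. -/
theorem two_smul_dualPoint_mem {r : ℕ} (hr : 1 ≤ r)
    (A : Matrix (Fin m) (Fin n) ℝ →ₗ[ℝ] EuclideanSpace ℝ (Fin p))
    (b : EuclideanSpace ℝ (Fin p)) {X : Matrix (Fin m) (Fin n) ℝ}
    (hX : IsStationaryPoint (objective r A b) X) :
    (2 : ℝ) • dualPoint A b X ∈ convexSubdifferential (convexPart r) X := by
  intro Y
  set H := Y - X with hH
  have key : ∀ ε : ℝ, 0 < ε → ∀ᶠ t : ℝ in 𝓝[>] 0,
      convexPart r X + inner ℝ ((2 : ℝ) • dualPoint A b X) H ≤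
        convexPart r Y + ε * ‖H‖ + t * ‖A H‖ ^ 2 := by
    intro ε hε
    have hlim : Tendsto (fun t : ℝ => X + t • H) (𝓝[>] 0) (𝓝 X) := by
      have : Continuous fun t : ℝ => X + t • H := by fun_prop
      simpa using (this.tendsto 0).mono_left nhdsWithin_le_nhds
    have hone : ∀ᶠ t : ℝ in 𝓝[>] 0, t < 1 := nhdsWithin_le_nhds (eventually_lt_nhds one_pos)
    filter_upwards [hlim.eventually (hX ε hε), self_mem_nhdsWithin, hone] with t ht ht0 ht1
    have ht0 : 0 < t := ht0
    have hconv := (convexOn_convexPart hr).2 (Set.mem_univ X) (Set.mem_univ Y)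
      (by linarith : 0 ≤ 1 - t) ht0.le (by ring)
    have hpt : (1 - t) • X + t • Y = X + t • H := by rw [hH]; module
    rw [hpt] at hconv
    have hA : A (X + t • H) - b = (A X - b) + t • A H := by rw [map_add, map_smul]; abel
    have hn1 := norm_add_sq_real (A X - b) (t • A H)
    have hn2 := norm_add_sq_real X (t • H)
    have hZ : inner ℝ ((2 : ℝ) • dualPoint A b X) H =
        2 * (inner ℝ X H - inner ℝ (A X - b) (A H)) := by
      rw [inner_smul_left, dualPoint, inner_add_left, inner_sub_left, LinearMap.adjoint_inner_left,
        LinearMap.adjoint_inner_left, inner_sub_left]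
      simp only [conj_trivial]
      ring
    rw [inner_smul_right, norm_smul, Real.norm_of_nonneg ht0.le] at hn1 hn2
    simp only [add_sub_cancel_left, inner_zero_left, objective, norm_smul,
      Real.norm_of_nonneg ht0.le, hA, hn1] at ht
    simp only [convexPart, smul_eq_mul, hn2] at hconv
    rw [hZ]
    simp only [convexPart]
    refine le_of_mul_le_mul_left ?_ ht0
    nlinarith [sq_nonneg (t * ‖H‖)]
  have hε : ∀ ε : ℝ, 0 < ε →
      convexPart r X + inner ℝ ((2 : ℝ) • dualPoint A b X) H ≤ convexPart r Y + ε * ‖H‖ := by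
    intro ε hε
    have hlim : Tendsto (fun t : ℝ => convexPart r Y + ε * ‖H‖ + t * ‖A H‖ ^ 2) (𝓝[>] 0)
        (𝓝 (convexPart r Y + ε * ‖H‖)) := by
      have : Continuous fun t : ℝ => convexPart r Y + ε * ‖H‖ + t * ‖A H‖ ^ 2 := by fun_prop
      simpa using (this.tendsto 0).mono_left nhdsWithin_le_nhds
    exact ge_of_tendsto hlim (key ε hε)
  have hlim : Tendsto (fun ε : ℝ => convexPart r Y + ε * ‖H‖) (𝓝[>] 0) (𝓝 (convexPart r Y)) := by
    have : Continuous fun ε : ℝ => convexPart r Y + ε * ‖H‖ := by fun_prop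
    simpa using (this.tendsto 0).mono_left nhdsWithin_le_nhds
  exact ge_of_tendsto hlim (by filter_upwards [self_mem_nhdsWithin] with ε h using hε ε h)

/-- On matrices of rank at most `r` the convex part is the squared norm, so a subgradient
inequality between two of them completes to a square. -/
theorem norm_sub_sq_le_of_mem {r : ℕ} (hr : 1 ≤ r) {X Y Z : Matrix (Fin m) (Fin n) ℝ}
    (hZ : (2 : ℝ) • Z ∈ convexSubdifferential (convexPart r) X)
    (hX : X.rank ≤ r) (hY : Y.rank ≤ r) : ‖Z - X‖ ^ 2 ≤ ‖Z - Y‖ ^ 2 := by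
  have h := hZ Y
  rw [convexPart_of_rank_le hr hX, convexPart_of_rank_le hr hY, inner_smul_left,
    inner_sub_right] at h
  simp only [conj_trivial] at h
  rw [norm_sub_sq_real, norm_sub_sq_real]
  linarith

/-! ### Spectral gap and uniqueness -/

/-- A spectral gap sharpens the minimality of a best rank-`r` approximation: the tail of `s X + E`
is still dominated by its head, so `s X` is a best approximation of `s X + E`. -/
theorem two_mul_inner_le_of_gap {r : ℕ} {s : ℝ} (hs : 0 < s)
    {X Y Z : Matrix (Fin m) (Fin n) ℝ} (hX : X.rank ≤ r) (hY : Y.rank ≤ r)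
    (hbest : ∀ W : Matrix (Fin m) (Fin n) ℝ, W.rank ≤ r → ‖Z - X‖ ^ 2 ≤ ‖Z - W‖ ^ 2)
    (hgap : singularValue Z r < singularValue Z (r - 1))
    (hgap' : singularValue Z r ≤ s * singularValue Z (r - 1)) :
    2 * inner ℝ (Z - X) (Y - X) ≤ s * ‖Y - X‖ ^ 2 := by
  obtain ⟨v, hv, hv'⟩ := exists_rightSingularBasis Z
  have hXv := apply_eq_of_best_approx hX hbest hgap v hv hv'
  -- `Z` with its first `r` singular values scaled by `s`
  set M := s • X + (Z - X) with hMdef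
  have hMv : ∀ i : Fin n, M.toEuclideanLin (v i) =
      (if r ≤ i.val then 1 else s) • Z.toEuclideanLin (v i) := by
    intro i
    rw [hMdef]
    simp only [map_add, map_sub, map_smul, LinearMap.add_apply, LinearMap.sub_apply,
      LinearMap.smul_apply, hXv]
    split_ifs <;> simp
  have hM : ∀ i j, i ≠ j → inner ℝ (M.toEuclideanLin (v i)) (M.toEuclideanLin (v j)) = 0 := by
    intro i j hij
    rw [hMv, hMv, inner_smul_left, inner_smul_right, hv i j hij, mul_zero, mul_zero]
  have hnorm : ‖Z - X‖ ^ 2 = ∑ i : Fin n with r ≤ i.val, ‖M.toEuclideanLin (v i)‖ ^ 2 := by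
    rw [norm_sq_eq_sum_norm_sq _ v, Finset.sum_filter]
    refine Finset.sum_congr rfl fun i _ => ?_
    rw [hMv, map_sub, LinearMap.sub_apply, hXv]
    split_ifs <;> simp
  have hsY : (s • Y).rank ≤ r := by
    rwa [Matrix.rank_smul_of_mem_nonZeroDivisors Y (mem_nonZeroDivisors_of_ne_zero hs.ne')]
  have h := sum_tail_le_norm_sub_sq (c := singularValue Z r ^ 2) v hM (fun i hi => ?_)
    (fun i hi => ?_) hsY
  · rw [← hnorm] at h
    have hsub : M - s • Y = (Z - X) - s • (Y - X) := by rw [hMdef]; module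
    rw [hsub, norm_sub_sq_real (Z - X), inner_smul_right, norm_smul, Real.norm_of_nonneg hs.le] at h
    refine le_of_mul_le_mul_left ?_ hs
    nlinarith
  · rw [hMv, if_neg (by omega), norm_smul, Real.norm_of_nonneg hs.le, hv']
    refine pow_le_pow_left₀ (singularValue_nonneg _ _) (hgap'.trans ?_) 2
    exact mul_le_mul_of_nonneg_left (singularValue_antitone _ (by omega)) hs.le
  · rw [hMv, if_pos hi, one_smul, hv']
    exact pow_le_pow_left₀ (singularValue_nonneg _ _) (singularValue_antitone _ hi) 2

theorem rank_sub_le (X Y : Matrix (Fin m) (Fin n) ℝ) : (X - Y).rank ≤ X.rank + Y.rank := by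
  refine (Submodule.finrank_mono (t := LinearMap.range X.mulVecLin ⊔ LinearMap.range Y.mulVecLin)
    ?_).trans (Submodule.finrank_add_le_finrank_add_finrank _ _)
  rintro _ ⟨w, rfl⟩
  rw [Matrix.mulVecLin_apply, Matrix.sub_mulVec]
  exact Submodule.sub_mem_sup ⟨w, rfl⟩ ⟨w, rfl⟩

theorem HasRIP.nonneg {q : ℕ} {δ : ℝ}
    {A : Matrix (Fin m) (Fin n) ℝ →ₗ[ℝ] EuclideanSpace ℝ (Fin p)} (hA : HasRIP A q δ)
    {X : Matrix (Fin m) (Fin n) ℝ} (hX : X.rank ≤ q) (hX0 : X ≠ 0) : 0 ≤ δ := by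
  have h := hA X hX
  have h0 : 0 < ‖X‖ ^ 2 := by positivity
  nlinarith [h.1, h.2]

/-- The difference of the dual points is `(I - A* A) (Y - X)`. -/
theorem inner_dualPoint_sub (A : Matrix (Fin m) (Fin n) ℝ →ₗ[ℝ] EuclideanSpace ℝ (Fin p))
    (b : EuclideanSpace ℝ (Fin p)) (X Y : Matrix (Fin m) (Fin n) ℝ) :
    inner ℝ (dualPoint A b Y - dualPoint A b X) (Y - X) = ‖Y - X‖ ^ 2 - ‖A (Y - X)‖ ^ 2 := by
  have h : dualPoint A b Y - dualPoint A b X = (Y - X) - A.adjoint (A (Y - X)) := by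
    simp only [dualPoint, map_sub]
    abel
  rw [h, inner_sub_left, LinearMap.adjoint_inner_left, real_inner_self_eq_norm_sq,
    real_inner_self_eq_norm_sq]

end LowRankRelaxation

theorem theorem1 {m n p : ℕ}
    (A : Matrix (Fin m) (Fin n) ℝ →ₗ[ℝ] EuclideanSpace ℝ (Fin p))
    (b : EuclideanSpace ℝ (Fin p)) (r : ℕ) (hr : 1 ≤ r)
    (δ : ℝ) (hRIP : LowRankRelaxation.HasRIP A (2 * r) δ)
    (Xs : Matrix (Fin m) (Fin n) ℝ)
    (hXs : LowRankRelaxation.IsStationaryPoint (LowRankRelaxation.objective r A b) Xs)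
    (hrank : Xs.rank = r)
    (Z : Matrix (Fin m) (Fin n) ℝ) (hZ : Z = LowRankRelaxation.dualPoint A b Xs) :
    (2 : ℝ) • Z ∈
        LowRankRelaxation.convexSubdifferential (LowRankRelaxation.convexPart r) Xs ∧
      (LowRankRelaxation.singularValue Z r <
          (1 - 2 * δ) * LowRankRelaxation.singularValue Z (r - 1) →
        ∀ X' : Matrix (Fin m) (Fin n) ℝ,
          LowRankRelaxation.IsStationaryPoint (LowRankRelaxation.objective r A b) X' →
          X' ≠ Xs → r < X'.rank) := by
  open LowRankRelaxation in
  have hsub : (2 : ℝ) • Z ∈ convexSubdifferential (convexPart r) Xs :=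
    hZ ▸ two_smul_dualPoint_mem hr A b hXs
  refine ⟨hsub, fun hgap X' hX' hne => ?_⟩
  by_contra! hrank'
  have hXs0 : Xs ≠ 0 := by
    rintro rfl
    rw [Matrix.rank_zero] at hrank
    omega
  have hδ : 0 ≤ δ := hRIP.nonneg (by omega) hXs0
  have hz := singularValue_nonneg Z r
  have hz' : 0 < singularValue Z (r - 1) := by
    refine lt_of_le_of_ne (singularValue_nonneg _ _) fun h => ?_
    rw [← h, mul_zero] at hgap
    exact absurd hgap hz.not_gt
  have hratio : singularValue Z r / singularValue Z (r - 1) < 1 - 2 * δ := (div_lt_iff₀ hz').2 hgap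
  -- strictly between the ratio of the two singular values and `1 - 2 δ`, hence positive
  -- even if the smaller singular value vanishes
  obtain ⟨s, hs, hs'⟩ := exists_between hratio
  have hs0 : 0 < s := (div_nonneg hz hz'.le).trans_lt hs
  have hgap' : singularValue Z r < s * singularValue Z (r - 1) := (div_lt_iff₀ hz').1 hs
  have hE := two_mul_inner_le_of_gap hs0 hrank.le hrank'
    (fun W hW => norm_sub_sq_le_of_mem hr hsub hrank.le hW) (by nlinarith) hgap'.le
  have hE' := norm_sub_sq_le_of_mem hr (two_smul_dualPoint_mem hr A b hX') hrank' hrank.le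
  have hsplit : dualPoint A b X' - Xs = (dualPoint A b X' - X') + (X' - Xs) := by abel
  rw [hsplit, norm_add_sq_real] at hE'
  have hD : 0 < ‖X' - Xs‖ ^ 2 := by
    have := norm_pos_iff.2 (sub_ne_zero.2 hne)
    positivity
  have hmono := inner_dualPoint_sub A b Xs X'
  have hdecomp : dualPoint A b X' - dualPoint A b Xs =
      (dualPoint A b X' - X') - (Z - Xs) + (X' - Xs) := by rw [hZ]; abel
  rw [hdecomp, inner_add_left, inner_sub_left, real_inner_self_eq_norm_sq] at hmono
  have hrdiff : (X' - Xs).rank ≤ 2 * r := by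
    have h1 := rank_sub_le X' Xs
    omega
  have hlow := (hRIP _ hrdiff).1
  nlinarith
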